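/- All graphs are finite and simple. A signed graph is a graph $G$ together with a function $p:E(G)\to\{0,1\}$; the parity of a cycle $C$ is $\sum_{e\in E(C)}p(e)$ modulo $2$, and $C$ is even if its parity is $0$ and odd if it is $1$. A signed graph is bipartite if all its cycles are even, and non-bipartite otherwise. It is 3-connected if it has at least four vertices and remains connected after the deletion of any set of at most two vertices. A cycle $C$ is non-separating in $G$ if $G-V(C)$ is connected. Let $t(G)=|E(G)|-|V(G)|+1$. **Lemma.** Let $G$ be a 3-connected non-bipartite signed graph, let $x$ be a vertex of $G$, and let $D$ be a non-separating induced odd cycle in $G$ with $x\notin V(D)$. For $i\in\{1,2,3\}$ let $R_i$ be a path in $G$ from $x$ to a vertex $z_i\in V(D)$, such that $R_1,R_2,R_3$ pairwise have no vertex in common other than $x$, and let $xy_i$ be the edge of $R_i$ incident to $x$. Let $f$ be any assignment of colours to the edges of $G$ incident to $x$ such that $f(xy_1),f(xy_2),f(xy_3)$ are distinct. Then for each parity $q\in\{0,1\}$, $G$ contains at least $t(G)$ distinct cycles of parity $q$ passing through $x$ such that the two edges incident to $x$ in each of these cycles have different colours under $f$. -/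

import Mathlib

/-- A signed graph: a simple graph together with a parity in `{0, 1} = ZMod 2` for every edge. -/
structure SignedGraph (V : Type*) where
  graph : SimpleGraph V
  sign : graph.edgeSet → ZMod 2

namespace SignedGraph

variable {V : Type*}

/-- The subgraph `C` is a cycle, that is, the subgraph traced by a closed walk of length at least
three with no repeated vertex. Two cycles are equal exactly if they are equal as subgraphs. -/
def IsCycle (G : SignedGraph V) (C : G.graph.Subgraph) : Prop :=
  ∃ (v : V) (w : G.graph.Walk v v), w.IsCycle ∧ w.toSubgraph = C

/-- The parity of a subgraph of a finite signed graph: the sum modulo 2 of the parities of its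
edges. -/
noncomputable def parity (G : SignedGraph V) (C : G.graph.Subgraph) : ZMod 2 :=
  ∑ᶠ e : C.edgeSet, G.sign ⟨e.1, C.edgeSet_subset e.2⟩

/-- A signed graph is bipartite if every cycle in it is even. -/
def IsBipartite (G : SignedGraph V) : Prop :=
  ∀ C : G.graph.Subgraph, G.IsCycle C → G.parity C = 0

/-- A finite signed graph is 3-connected if its graph has at least four vertices and stays
connected after the deletion of any set of at most two vertices. -/
def IsThreeConnected (G : SignedGraph V) : Prop :=
  4 ≤ Nat.card V ∧ ∀ S : Set V, S.ncard ≤ 2 → (G.graph.induce Sᶜ).Connected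

/-- `t(G) = |E(G)| - |V(G)| + 1`, for a finite graph, as an integer. -/
noncomputable def t (G : SignedGraph V) : ℤ :=
  (Nat.card G.graph.edgeSet : ℤ) - (Nat.card V : ℤ) + 1

/-- The subgraph `D` is non-separating: deleting its vertices leaves a connected graph. -/
def IsNonSeparating (G : SignedGraph V) (D : G.graph.Subgraph) : Prop :=
  (G.graph.induce D.vertsᶜ).Connected

/-- No two different edges of `C` at `x` have the same colour. -/
def HasDistinctColorsAt {κ : Type*} (G : SignedGraph V) (x : V)
    (f : G.graph.incidenceSet x → κ) (C : G.graph.Subgraph) : Prop :=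
  ∀ e₁ e₂ : G.graph.incidenceSet x, e₁.1 ∈ C.edgeSet → e₂.1 ∈ C.edgeSet → e₁ ≠ e₂ → f e₁ ≠ f e₂

end SignedGraph

/-! Call a bicoloured ear the edge set of two paths leaving `x` with different colours, meeting only
in `x`, and reaching `D` at different vertices, where they stop. Its two ends cut the odd cycle `D`
into two arcs of different parity, so for each `q` exactly one arc closes the ear up to a cycle of
parity `q`. The ear is what remains of this cycle after removing the edges of `D`, so different ears
give different cycles. It therefore suffices to find `t(G)` bicoloured ears
(`SignedGraph.exists_isCycle_of_isBicolouredEar`).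

The ears are counted along an ear decomposition that starts from `D` and the three given paths. The
invariant (`IsEarFrame`) is that a part with vertex set `U` and edge set `A` contains at least `|A|
- |U| + 1` bicoloured ears. At the start this number is at most 3, and the three pairs of paths are
bicoloured ears. Attaching a path raises `|A| - |U|` by at most one, so each attachment has to yield
one new bicoloured ear. For this it is enough that some bicoloured ear uses the whole attached path,
since such an ear was not there before.

That such an ear always exists is the second half of the invariant (`IsCompletable`). It is checked
by cases for the initial part and is inherited by each larger part. It needs attached paths whose
ends are not both in `D`. Connectivity of `G - V(D)`, and of `G` minus one vertex, guarantees that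
such a path exists until all of `G` is exhausted (`IsEarFrame.exists_ear`). -/

namespace SimpleGraph

variable {V κ : Type*} {G : SimpleGraph V}

/-! ### Paths: concatenation, first hits of a set, edge and vertex counts -/

namespace Walk

theorem IsPath.append_of_inter {u v w : V} {p : G.Walk u v} {q : G.Walk v w}
    (hp : p.IsPath) (hq : q.IsPath) (h : ∀ a ∈ p.support, a ∈ q.support → a = v) :
    (p.append q).IsPath := by
  rw [isPath_def, support_append, List.nodup_append']
  refine ⟨hp.support_nodup, hq.support_nodup.tail, fun a ha hb => ?_⟩
  have := h a ha (List.mem_of_mem_tail hb)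
  subst this
  have hn := hq.support_nodup
  rw [← cons_tail_support, List.nodup_cons] at hn
  exact hn.1 hb

theorem IsPath.eq_of_mem_append {u v w a : V} {p : G.Walk u v} {q : G.Walk v w}
    (h : (p.append q).IsPath) (hp : a ∈ p.support) (hq : a ∈ q.support) : a = v := by
  by_contra hne
  exact h.ne_of_mem_support_of_append hne hp hq rfl

/-- Every walk that ends in `U` has an initial segment that meets `U` only in its last vertex. -/
theorem exists_append_first_mem {u v : V} (p : G.Walk u v) (U : Set V) (hv : v ∈ U) :
    ∃ w ∈ U, ∃ (q : G.Walk u w) (r : G.Walk w v), p = q.append r ∧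
      ∀ a ∈ q.support, a ∈ U → a = w := by
  induction p with
  | nil => exact ⟨_, hv, nil, nil, rfl, by simp⟩
  | @cons a b c h p ih =>
    by_cases ha : a ∈ U
    · exact ⟨a, ha, nil, cons h p, rfl, by simp⟩
    · obtain ⟨w, hw, q, r, hqr, hq⟩ := ih hv
      refine ⟨w, hw, cons h q, r, by rw [hqr, cons_append], ?_⟩
      intro t ht htU
      rw [support_cons, List.mem_cons] at ht
      rcases ht with rfl | ht
      · exact absurd htU ha
      · exact hq t ht htU

/-- A vertex from which a set `U` can be reached while avoiding `X` is joined to `U` by a path that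
avoids `X` and meets `U` only in its last vertex. -/
theorem exists_isPath_first_mem {u v : V} (p : G.Walk u v) (U : Set V) (hv : v ∈ U) :
    ∃ w ∈ U, ∃ q : G.Walk u w, q.IsPath ∧ q.support ⊆ p.support ∧
      ∀ a ∈ q.support, a ∈ U → a = w := by
  classical
  obtain ⟨w, hw, q, r, rfl, hq⟩ := p.exists_append_first_mem U hv
  refine ⟨w, hw, q.bypass, q.bypass_isPath, ?_,
    fun a ha => hq a (q.support_bypass_subset_support ha)⟩
  intro a ha
  exact (mem_support_append_iff _ _).2 (Or.inl (q.support_bypass_subset_support ha))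

theorem exists_mem_edges {u v : V} (p : G.Walk u v) (h : u ≠ v) : ∃ y, s(u, y) ∈ p.edges := by
  cases p with
  | nil => exact absurd rfl h
  | @cons _ b _ hab q => exact ⟨b, by simp⟩

theorem fst_mem_of_mem_edges {u v a b : V} {p : G.Walk u v} (h : s(a, b) ∈ p.edges) :
    a ∈ p.support := p.fst_mem_support_of_mem_edges h

theorem IsTrail.ncard_setOf_mem_edges {u v : V} {p : G.Walk u v} (hp : p.IsTrail) :
    ({e | e ∈ p.edges} : Set (Sym2 V)).ncard = p.length := by
  classical
  rw [← p.length_edges, ← List.toFinset_card_of_nodup hp.edges_nodup, ← Set.ncard_coe_finset]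
  congr 1; ext; simp

theorem IsPath.ncard_setOf_mem_support {u v : V} {p : G.Walk u v} (hp : p.IsPath) :
    ({a | a ∈ p.support} : Set V).ncard = p.length + 1 := by
  classical
  rw [← p.length_support, ← List.toFinset_card_of_nodup hp.support_nodup, ← Set.ncard_coe_finset]
  congr 1; ext; simp

/-- Attaching a path with both ends in `U` adds at most one more edge than vertices. -/
theorem IsPath.ncard_union_edges_le [Finite V] {u v : V} {p : G.Walk u v} (hp : p.IsPath)
    (U : Set V) (A : Set (Sym2 V)) (hpU : ∀ a ∈ p.support, a ∈ U → a = u ∨ a = v) :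
    (A ∪ {e | e ∈ p.edges}).ncard + U.ncard ≤ A.ncard + (U ∪ {a | a ∈ p.support}).ncard + 1 := by
  have h1 := hp.isTrail.ncard_setOf_mem_edges
  have h2 := hp.ncard_setOf_mem_support
  have h3 := Set.ncard_union_le A {e | e ∈ p.edges}
  have h4 := Set.ncard_union_add_ncard_inter U {a | a ∈ p.support}
  have h5 : (U ∩ {a | a ∈ p.support}).ncard ≤ ({u, v} : Set V).ncard :=
    Set.ncard_le_ncard (fun a ha => hpU a ha.2 ha.1) (Set.toFinite _)
  have h6 := Set.ncard_insert_le u {v}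
  rw [Set.ncard_singleton] at h6
  omega

/-- Attaching a path with only one end in `U` adds at most as many edges as vertices. -/
theorem IsPath.ncard_union_edges_le_of_pendant [Finite V] {u v : V} {p : G.Walk u v}
    (hp : p.IsPath) (U : Set V) (A : Set (Sym2 V)) (hpU : ∀ a ∈ p.support, a ∈ U → a = v) :
    (A ∪ {e | e ∈ p.edges}).ncard + U.ncard ≤ A.ncard + (U ∪ {a | a ∈ p.support}).ncard := by
  have h1 := hp.isTrail.ncard_setOf_mem_edges
  have h2 := hp.ncard_setOf_mem_support
  have h3 := Set.ncard_union_le A {e | e ∈ p.edges}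
  have h4 := Set.ncard_union_add_ncard_inter U {a | a ∈ p.support}
  have h5 : (U ∩ {a | a ∈ p.support}).ncard ≤ ({v} : Set V).ncard :=
    Set.ncard_le_ncard (fun a ha => hpU a ha.2 ha.1) (Set.toFinite _)
  rw [Set.ncard_singleton] at h5
  omega

end Walk

/-! ### Bicoloured ears and completability -/

/-- `S` is the edge set of two paths that start at `x` with different colours, share only `x`, and
end at different vertices of `D`, having no other vertices in `D`. -/
def IsBicolouredEar (G : SimpleGraph V) (D : Set V) (x : V) (c : V → κ) (S : Set (Sym2 V)) : Prop :=
  ∃ z ∈ D, ∃ z' ∈ D, z ≠ z' ∧ ∃ (P : G.Walk x z) (P' : G.Walk x z'), P.IsPath ∧ P'.IsPath ∧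
    (∀ a ∈ P.support, a ∈ D → a = z) ∧ (∀ a ∈ P'.support, a ∈ D → a = z') ∧
    (∀ a ∈ P.support, a ∈ P'.support → a = x) ∧
    (∀ y y', s(x, y) ∈ P.edges → s(x, y') ∈ P'.edges → c y ≠ c y') ∧
    S = {e | e ∈ P.edges} ∪ {e | e ∈ P'.edges}

/-- `Q` is a path with no inner vertex in `U` and no edge in `A`. -/
def Walk.IsExternal {u v : V} (Q : G.Walk u v) (U : Set V) (A : Set (Sym2 V)) : Prop :=
  Q.IsPath ∧ (∀ a ∈ Q.support, a ∈ U → a = u ∨ a = v) ∧ ∀ e ∈ Q.edges, e ∉ A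

theorem Walk.IsExternal.reverse {u v : V} {Q : G.Walk u v} {U : Set V} {A : Set (Sym2 V)}
    (h : Q.IsExternal U A) : Q.reverse.IsExternal U A :=
  ⟨h.1.reverse, fun a ha hU => (h.2.1 a (by simpa using ha) hU).symm,
    fun e he => h.2.2 e (by simpa using he)⟩

/-- Every external path of `(U, A)` whose ends differ after contracting `D` extends through `A` to a
bicoloured ear. -/
def IsCompletable (G : SimpleGraph V) (D : Set V) (x : V) (c : V → κ) (U : Set V)
    (A : Set (Sym2 V)) : Prop :=
  ∀ u ∈ U, ∀ v ∈ U, u ≠ v → ¬ (u ∈ D ∧ v ∈ D) → ∀ Q : G.Walk u v, Q.IsExternal U A →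
    ∃ S, G.IsBicolouredEar D x c S ∧ S ⊆ A ∪ {e | e ∈ Q.edges} ∧ {e | e ∈ Q.edges} ⊆ S

/-- An external path `Q` of the larger part becomes an external path of the old part once its ends
lying inside `E` are prolonged along `E` to ends of `E`. The ear that the old part supplies for the
prolonged path also contains `Q`. The prolongations `q` and `r` have to be disjoint, and the new
ends must not be identified when `D` is contracted. -/
theorem IsCompletable.union_ear {D U : Set V} {A : Set (Sym2 V)} {x : V} {c : V → κ}
    (hA : G.IsCompletable D x c U A) {a b : V} (ha : a ∈ U) (hb : b ∈ U) (hab : a ≠ b)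
    (habD : ¬ (a ∈ D ∧ b ∈ D)) {E : G.Walk a b} (hE : E.IsExternal U A) :
    G.IsCompletable D x c (U ∪ {t | t ∈ E.support}) (A ∪ {e | e ∈ E.edges}) := by
  have key : ∀ {u v : V} (u' v' : V), u' ∈ U → v' ∈ U → u' ≠ v' → ¬ (u' ∈ D ∧ v' ∈ D) →
      ∀ (Q : G.Walk u v), Q.IsExternal (U ∪ {t | t ∈ E.support}) (A ∪ {e | e ∈ E.edges}) →
      ∀ (q : G.Walk u' u) (r : G.Walk v v'), q.IsPath → r.IsPath →
      (∀ t ∈ q.support, t ∈ r.support → False) → u ≠ v →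
      (∀ t ∈ q.support, t ∈ E.support ∨ t = u) → (∀ t ∈ r.support, t ∈ E.support ∨ t = v) →
      (∀ t ∈ q.support, t ∈ U → t = u') → (∀ t ∈ r.support, t ∈ U → t = v') →
      u ∈ U ∪ {t | t ∈ E.support} → v ∈ U ∪ {t | t ∈ E.support} →
      (∀ e ∈ q.edges, e ∈ E.edges) → (∀ e ∈ r.edges, e ∈ E.edges) →
      ∃ S, G.IsBicolouredEar D x c S ∧ S ⊆ A ∪ {e | e ∈ E.edges} ∪ {e | e ∈ Q.edges} ∧
        {e | e ∈ Q.edges} ⊆ S := by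
    intro u v u' v' hu' hv' hne hD Q hQ q r hq hr hqr huv hqE hrE hqU hrU hu hv hqe hre
    have hqQ : ∀ t ∈ q.support, t ∈ Q.support → t = u := by
      intro t ht htQ
      rcases hqE t ht with h | h
      · rcases hQ.2.1 t htQ (Or.inr h) with h | h
        · exact h
        · subst h; exact (hqr t ht r.start_mem_support).elim
      · exact h
    have hrQ : ∀ t ∈ r.support, t ∈ Q.support → t = v := by
      intro t ht htQ
      rcases hrE t ht with h | h
      · rcases hQ.2.1 t htQ (Or.inr h) with h | h
        · subst h; exact (hqr t q.end_mem_support ht).elim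
        · exact h
      · exact h
    have hpath : (q.append (Q.append r)).IsPath := by
      refine hq.append_of_inter (hQ.1.append_of_inter hr fun t h1 h2 => hrQ t h2 h1) ?_
      intro t h1 h2
      rcases (Walk.mem_support_append_iff _ _).1 h2 with h2 | h2
      · exact hqQ t h1 h2
      · exact (hqr t h1 h2).elim
    obtain ⟨S, hS, hSA, hQS⟩ := hA u' hu' v' hv' hne hD (q.append (Q.append r)) ⟨hpath, by
      intro t ht htU
      simp only [Walk.mem_support_append_iff] at ht
      rcases ht with ht | ht | ht
      · exact Or.inl (hqU t ht htU)
      · rcases hQ.2.1 t ht (Or.inl htU) with rfl | rfl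
        · exact Or.inl (hqU _ q.end_mem_support htU)
        · exact Or.inr (hrU _ r.start_mem_support htU)
      · exact Or.inr (hrU t ht htU), by
      intro e he heA
      simp only [Walk.edges_append, List.mem_append] at he
      rcases he with he | he | he
      · exact hE.2.2 e (hqe e he) heA
      · exact hQ.2.2 e he (Or.inl heA)
      · exact hE.2.2 e (hre e he) heA⟩
    refine ⟨S, hS, ?_, fun e he => hQS ?_⟩
    · intro e he
      rcases hSA he with h | h
      · exact Or.inl (Or.inl h)
      · simp only [Set.mem_ofPred_eq, Walk.edges_append, List.mem_append] at h
        rcases h with h | h | h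
        · exact Or.inl (Or.inr (hqe e h))
        · exact Or.inr h
        · exact Or.inl (Or.inr (hre e h))
    · simp only [Set.mem_ofPred_eq, Walk.edges_append, List.mem_append] at he ⊢
      exact Or.inr (Or.inl he)
  have half : ∀ {u v : V}, u ∈ E.support → u ∉ U → v ∈ U → u ≠ v →
      ∀ (Q : G.Walk u v), Q.IsExternal (U ∪ {t | t ∈ E.support}) (A ∪ {e | e ∈ E.edges}) →
      ∃ S, G.IsBicolouredEar D x c S ∧ S ⊆ A ∪ {e | e ∈ E.edges} ∪ {e | e ∈ Q.edges} ∧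
        {e | e ∈ Q.edges} ⊆ S := by
    intro u v huE huU hv huv Q hQ
    obtain ⟨q, r, hq, hr, hqr⟩ := hE.1.mem_support_iff_exists_append.1 huE
    have hqE : ∀ t ∈ q.support, t ∈ E.support := fun t ht => by
      rw [hqr]; exact (Walk.mem_support_append_iff _ _).2 (Or.inl ht)
    have hrE : ∀ t ∈ r.support, t ∈ E.support := fun t ht => by
      rw [hqr]; exact (Walk.mem_support_append_iff _ _).2 (Or.inr ht)
    have hqe : ∀ t ∈ q.edges, t ∈ E.edges := fun t ht => by
      rw [hqr, Walk.edges_append]; exact List.mem_append_left _ ht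
    have hre : ∀ t ∈ r.edges, t ∈ E.edges := fun t ht => by
      rw [hqr, Walk.edges_append]; exact List.mem_append_right _ ht
    have hcap : ∀ t, t ∈ q.support → t ∈ r.support → t = u := fun t =>
      (hqr ▸ hE.1 : (q.append r).IsPath).eq_of_mem_append
    have hqU : ∀ t ∈ q.support, t ∈ U → t = a := by
      intro t ht htU
      rcases hE.2.1 t (hqE t ht) htU with h | h
      · exact h
      · subst h
        exact absurd (hcap t ht r.end_mem_support ▸ htU) huU
    have hrU : ∀ t ∈ r.support, t ∈ U → t = b := by
      intro t ht htU
      rcases hE.2.1 t (hrE t ht) htU with h | h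
      · subst h
        exact absurd (hcap t q.start_mem_support ht ▸ htU) huU
      · exact h
    -- Prolong `Q` to whichever end of `E` differs from `v` after contracting `D`. One of them does,
    -- because `a` and `b` are themselves different there.
    by_cases hav : a ≠ v ∧ ¬ (a ∈ D ∧ v ∈ D)
    · refine key a v ha hv hav.1 hav.2 Q hQ q Walk.nil hq Walk.IsPath.nil ?_ huv
        (fun t ht => Or.inl (hqE t ht)) (by simp) hqU (by simp) (Or.inr huE) (Or.inl hv) hqe
        (by simp)
      intro t ht htv
      simp only [Walk.support_nil, List.mem_singleton] at htv
      subst htv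
      exact hav.1 (hqU t ht hv).symm
    · have hbv : b ≠ v ∧ ¬ (b ∈ D ∧ v ∈ D) := by
        by_cases h : a = v
        · subst h; exact ⟨hab.symm, fun h => habD ⟨h.2, h.1⟩⟩
        · have h' : a ∈ D ∧ v ∈ D := by
            by_contra h'; exact hav ⟨h, h'⟩
          have hbD : b ∉ D := fun hb' => habD ⟨h'.1, hb'⟩
          exact ⟨fun e => hbD (e ▸ h'.2), fun h => hbD h.1⟩
      refine key b v hb hv hbv.1 hbv.2 Q hQ r.reverse Walk.nil hr.reverse Walk.IsPath.nil ?_ huv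
        (fun t ht => Or.inl (hrE t (by simpa using ht))) (by simp)
        (fun t ht => hrU t (by simpa using ht)) (by simp) (Or.inr huE) (Or.inl hv)
        (fun t ht => hre t (by simpa using ht)) (by simp)
      intro t ht htv
      simp only [Walk.support_nil, List.mem_singleton] at htv
      subst htv
      exact hbv.1 (hrU t (by simpa using ht) hv).symm
  have both : ∀ {u v : V}, u ∉ U → v ∉ U → u ≠ v →
      ∀ (Q : G.Walk u v), Q.IsExternal (U ∪ {t | t ∈ E.support}) (A ∪ {e | e ∈ E.edges}) →
      ∀ (q : G.Walk a u) (m : G.Walk u v) (r : G.Walk v b), E = q.append (m.append r) →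
      ∃ S, G.IsBicolouredEar D x c S ∧ S ⊆ A ∪ {e | e ∈ E.edges} ∪ {e | e ∈ Q.edges} ∧
        {e | e ∈ Q.edges} ⊆ S := by
    intro u v huU hvU huv Q hQ q m r hqr
    have hP : (q.append (m.append r)).IsPath := hqr ▸ hE.1
    have hcap : ∀ t, t ∈ q.support → t ∈ r.support → False := by
      intro t h1 h2
      have h3 := hP.eq_of_mem_append h1 ((Walk.mem_support_append_iff _ _).2 (Or.inr h2))
      subst h3
      exact huv (hP.of_append_right.eq_of_mem_append m.start_mem_support h2)
    have hqE : ∀ t ∈ q.support, t ∈ E.support := fun t ht => by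
      rw [hqr]; simp [Walk.mem_support_append_iff, ht]
    have hrE : ∀ t ∈ r.support, t ∈ E.support := fun t ht => by
      rw [hqr]; simp [Walk.mem_support_append_iff, ht]
    -- With both ends of `Q` inside `E`, the outer segments of `E` are kept and the middle segment
    -- is replaced by `Q`.
    refine key a b ha hb hab habD Q hQ q r hP.of_append_left hP.of_append_right.of_append_right
      hcap huv (fun t ht => Or.inl (hqE t ht)) (fun t ht => Or.inl (hrE t ht)) ?_ ?_
      (Or.inr (hqE _ q.end_mem_support)) (Or.inr (hrE _ r.start_mem_support))
      (fun t ht => by rw [hqr]; simp [ht]) (fun t ht => by rw [hqr]; simp [ht])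
    · intro t ht htU
      rcases hE.2.1 t (hqE t ht) htU with h | h
      · exact h
      · subst h; exact (hcap t ht r.end_mem_support).elim
    · intro t ht htU
      rcases hE.2.1 t (hrE t ht) htU with h | h
      · subst h; exact (hcap t q.start_mem_support ht).elim
      · exact h
  have flip : ∀ {u v : V} (Q : G.Walk u v), (∃ S, G.IsBicolouredEar D x c S ∧
      S ⊆ A ∪ {e | e ∈ E.edges} ∪ {e | e ∈ Q.reverse.edges} ∧ {e | e ∈ Q.reverse.edges} ⊆ S) →
      ∃ S, G.IsBicolouredEar D x c S ∧ S ⊆ A ∪ {e | e ∈ E.edges} ∪ {e | e ∈ Q.edges} ∧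
        {e | e ∈ Q.edges} ⊆ S := by
    intro u v Q h
    simpa using h
  intro u hu v hv huv hD Q hQ
  by_cases huU : u ∈ U
  · by_cases hvU : v ∈ U
    · obtain ⟨S, h1, h2, h3⟩ := hA u huU v hvU huv hD Q
        ⟨hQ.1, fun t ht h => hQ.2.1 t ht (Or.inl h), fun e he h => hQ.2.2 e he (Or.inl h)⟩
      refine ⟨S, h1, h2.trans (Set.union_subset_union_left _ Set.subset_union_left), h3⟩
    · exact flip Q (half (hv.resolve_left hvU) hvU huU huv.symm Q.reverse hQ.reverse)
  · have huE : u ∈ E.support := hu.resolve_left huU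
    by_cases hvU : v ∈ U
    · exact half huE huU hvU huv Q hQ
    · have hvE : v ∈ E.support := hv.resolve_left hvU
      obtain ⟨q, r, hqr⟩ := Walk.mem_support_iff_exists_append.1 huE
      have hv' := hvE
      rw [hqr, Walk.mem_support_append_iff] at hv'
      rcases hv' with h | h
      · obtain ⟨q₁, q₂, rfl⟩ := Walk.mem_support_iff_exists_append.1 h
        exact flip Q (both hvU huU huv.symm Q.reverse hQ.reverse q₁ q₂ r
          (by rw [hqr, Walk.append_assoc]))
      · obtain ⟨r₁, r₂, rfl⟩ := Walk.mem_support_iff_exists_append.1 h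
        exact both huU hvU huv Q hQ q r₁ r₂ hqr

/-! ### Growing a frame until it is the whole graph -/

/-- The vertex set `U` and the edge set `A` contain `D` with all edges inside it, and contain enough
bicoloured ears to be extended by further ears. -/
structure IsEarFrame (G : SimpleGraph V) (D : Set V) (x : V) (c : V → κ) (U : Set V)
    (A : Set (Sym2 V)) : Prop where
  subset : D ⊆ U
  mem : x ∈ U
  mem_of_edge : ∀ a b, s(a, b) ∈ A → a ∈ U
  edge_mem : ∀ a ∈ D, ∀ b ∈ D, G.Adj a b → s(a, b) ∈ A
  completable : G.IsCompletable D x c U A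
  count : A.ncard + 1 ≤ {S | G.IsBicolouredEar D x c S ∧ S ⊆ A}.ncard + U.ncard

theorem IsEarFrame.union_ear [Finite V] {D U : Set V} {A : Set (Sym2 V)} {x : V} {c : V → κ}
    (hA : G.IsEarFrame D x c U A) {a b : V} (ha : a ∈ U) (hb : b ∈ U) (hab : a ≠ b)
    (habD : ¬ (a ∈ D ∧ b ∈ D)) {E : G.Walk a b} (hE : E.IsExternal U A) :
    G.IsEarFrame D x c (U ∪ {t | t ∈ E.support}) (A ∪ {e | e ∈ E.edges}) where
  subset := hA.subset.trans Set.subset_union_left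
  mem := Or.inl hA.mem
  mem_of_edge p q h := h.imp (hA.mem_of_edge p q) Walk.fst_mem_of_mem_edges
  edge_mem p hp q hq h := Or.inl (hA.edge_mem p hp q hq h)
  completable := hA.completable.union_ear ha hb hab habD hE
  count := by
    obtain ⟨S, hS, hSA, hES⟩ := hA.completable a ha b hb hab habD E hE
    obtain ⟨y, hy⟩ := E.exists_mem_edges hab
    -- The completing ear uses an edge of `E`, which is not in `A`, so it has not been counted
    -- before.
    have hnot : S ∉ {S | G.IsBicolouredEar D x c S ∧ S ⊆ A} :=
      fun h => hE.2.2 _ hy (h.2 (hES hy))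
    have h1 : insert S {S | G.IsBicolouredEar D x c S ∧ S ⊆ A} ⊆
        {S | G.IsBicolouredEar D x c S ∧ S ⊆ A ∪ {e | e ∈ E.edges}} := by
      rintro T (rfl | hT)
      · exact ⟨hS, hSA⟩
      · exact ⟨hT.1, hT.2.trans Set.subset_union_left⟩
    have h2 := Set.ncard_le_ncard h1 (Set.toFinite _)
    rw [Set.ncard_insert_of_notMem hnot (Set.toFinite _)] at h2
    have h3 := hE.1.ncard_union_edges_le U A hE.2.1
    have h4 := hA.count
    omega

/-- The first edge is new because `b` lies outside `U`. An edge of `q` in `A` would have both ends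
in `U`, hence both equal to `w`. -/
theorem Walk.isExternal_cons {U : Set V} {A : Set (Sym2 V)} {a b w : V} {q : G.Walk b w}
    (hmem : ∀ a b, s(a, b) ∈ A → a ∈ U)
    (hq : q.IsPath) (hqU : ∀ t ∈ q.support, t ∈ U → t = w) (hb : b ∉ U) (haq : a ∉ q.support)
    (h : G.Adj a b) : (Walk.cons h q).IsExternal U A := by
  refine ⟨(Walk.cons_isPath_iff h q).2 ⟨hq, haq⟩, ?_, ?_⟩
  · intro t ht htU
    rw [Walk.support_cons, List.mem_cons] at ht
    exact ht.imp_right fun ht => hqU t ht htU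
  · intro e he heA
    rw [Walk.edges_cons, List.mem_cons] at he
    rcases he with rfl | he
    · exact hb (hmem b a (Sym2.eq_swap ▸ heA))
    · induction e with
      | _ p r =>
        have h1 := hqU p (q.fst_mem_support_of_mem_edges he) (hmem p r heA)
        have h2 := hqU r (q.snd_mem_support_of_mem_edges he) (hmem r p (Sym2.eq_swap ▸ heA))
        exact (q.adj_of_mem_edges he).ne (h1.trans h2.symm)

/-- If all vertices are present, a missing edge is itself the path. Otherwise take an edge from `a`
in `U` to `b` outside, and return from `b` to `U`: inside `G - V(D)` towards `x` if `a` is in `D`,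
and inside `G - a` towards `D` if not. Either way the two ends differ and do not both lie in `D`. -/
theorem IsEarFrame.exists_ear {D U : Set V} {A : Set (Sym2 V)} {x : V} {c : V → κ}
    (hA : G.IsEarFrame D x c U A) (hx : x ∉ D)
    (hcon : ∀ a ∉ D, ∀ b, b ≠ a → ∃ d ∈ D, ∃ w : G.Walk b d, a ∉ w.support)
    (hsep : ∀ b ∉ D, ∃ w : G.Walk b x, ∀ t ∈ w.support, t ∉ D)
    (hne : ¬ (G.edgeSet ⊆ A ∧ U = Set.univ)) :
    ∃ a ∈ U, ∃ b ∈ U, a ≠ b ∧ ¬ (a ∈ D ∧ b ∈ D) ∧ ∃ E : G.Walk a b, E.IsExternal U A := by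
  by_cases hU : U = Set.univ
  · have hedge : ¬ G.edgeSet ⊆ A := fun h => hne ⟨h, hU⟩
    obtain ⟨e, he, heA⟩ := Set.not_subset.1 hedge
    induction e with
    | _ a b =>
      have hadj : G.Adj a b := he
      refine ⟨a, hU ▸ trivial, b, hU ▸ trivial, hadj.ne,
        fun h => heA (hA.edge_mem a h.1 b h.2 hadj), hadj.toWalk, ?_, ?_, ?_⟩
      · exact (Walk.cons_isPath_iff _ _).2 ⟨Walk.IsPath.nil, by simpa using hadj.ne⟩
      · intro t ht _
        simpa using ht
      · intro e he
        have : e = s(a, b) := by simpa using he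
        rwa [this]
  · obtain ⟨b₀, hb₀⟩ := (Set.ne_univ_iff_exists_notMem U).1 hU
    -- This walk serves only to find an edge between `U` and its complement.
    obtain ⟨d, hd, w, -⟩ := hcon x hx b₀ (fun h => hb₀ (h ▸ hA.mem))
    obtain ⟨⟨⟨b, a⟩, hba⟩, -, hb, ha⟩ := w.exists_boundary_dart Uᶜ hb₀ (fun h => h (hA.subset hd))
    simp only [Set.mem_compl_iff, not_not] at hb ha
    by_cases haD : a ∈ D
    · obtain ⟨w, hw⟩ := hsep b (fun h => hb (hA.subset h))
      obtain ⟨t, ht, q, hq, hqw, hqU⟩ := w.exists_isPath_first_mem U hA.mem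
      have htD : t ∉ D := hw t (hqw q.end_mem_support)
      exact ⟨a, ha, t, ht, fun h => htD (h ▸ haD), fun h => htD h.2, Walk.cons hba.symm q,
        Walk.isExternal_cons hA.mem_of_edge hq hqU hb (fun h => hw a (hqw h) haD) _⟩
    · obtain ⟨d, hd, w, hw⟩ := hcon a haD b hba.ne
      obtain ⟨t, ht, q, hq, hqw, hqU⟩ := w.exists_isPath_first_mem U (hA.subset hd)
      exact ⟨a, ha, t, ht, fun h => hw (hqw (h ▸ q.end_mem_support)), fun h => haD h.1,
        Walk.cons hba.symm q,
        Walk.isExternal_cons hA.mem_of_edge hq hqU hb (fun h => hw (hqw h)) _⟩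

theorem IsEarFrame.ncard_edgeSet_le [Finite V] {D U : Set V} {A : Set (Sym2 V)} {x : V}
    {c : V → κ} (hA : G.IsEarFrame D x c U A) (hx : x ∉ D)
    (hcon : ∀ a ∉ D, ∀ b, b ≠ a → ∃ d ∈ D, ∃ w : G.Walk b d, a ∉ w.support)
    (hsep : ∀ b ∉ D, ∃ w : G.Walk b x, ∀ t ∈ w.support, t ∉ D) :
    G.edgeSet.ncard + 1 ≤ {S | G.IsBicolouredEar D x c S}.ncard + Nat.card V := by
  -- Each attached path puts at least one new pair into `A`, so the complement shrinks.
  induction hn : (Aᶜ).ncard using Nat.strong_induction_on generalizing U A with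
  | _ n ih =>
    by_cases hfull : G.edgeSet ⊆ A ∧ U = Set.univ
    · have h1 := Set.ncard_le_ncard hfull.1 (Set.toFinite _)
      have h2 : {S | G.IsBicolouredEar D x c S ∧ S ⊆ A}.ncard ≤
          {S | G.IsBicolouredEar D x c S}.ncard :=
        Set.ncard_le_ncard (fun S h => h.1) (Set.toFinite _)
      have h3 := hA.count
      rw [hfull.2, Set.ncard_univ] at h3
      omega
    · obtain ⟨a, ha, b, hb, hab, habD, E, hE⟩ := hA.exists_ear hx hcon hsep hfull
      refine ih _ ?_ (hA.union_ear ha hb hab habD hE) rfl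
      rw [← hn]
      obtain ⟨y, hy⟩ := E.exists_mem_edges hab
      refine Set.ncard_lt_ncard ?_ (Set.toFinite _)
      refine (Set.ssubset_iff_of_subset (Set.compl_subset_compl.2 Set.subset_union_left)).2
        ⟨s(a, y), hE.2.2 _ hy, fun h => h (Or.inr hy)⟩

/-! ### The initial frame: `D` with three paths from `x` -/

section Theta

variable {D : Set V} {x : V} {c : V → κ} {z : Fin 3 → V} {R : ∀ i, G.Walk x (z i)}

/-- Splice `Q` into the three paths to get a path `P` from `x` to `D` through `Q`, and pair `P` with
some `R k` that it meets only in `x`. If `P` starts along `R i`, its colour differs from that of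
every other path. If `Q` starts at `x`, the colour of `P` is unknown but agrees with that of at most
one path, so two candidates for `k` suffice. -/
theorem isCompletable_of_three_paths (hz : ∀ i, z i ∈ D) (hR : ∀ i, (R i).IsPath)
    (hRD : ∀ i, ∀ a ∈ (R i).support, a ∈ D → a = z i) (hx : x ∉ D)
    (hdisj : ∀ i j, i ≠ j → ∀ a ∈ (R i).support, a ∈ (R j).support → a = x)
    (hc : ∀ i j, i ≠ j → ∀ y y', s(x, y) ∈ (R i).edges → s(x, y') ∈ (R j).edges → c y ≠ c y')
    {A : Set (Sym2 V)} (hRA : ∀ i, ∀ e ∈ (R i).edges, e ∈ A) :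
    G.IsCompletable D x c (D ∪ {a | ∃ i, a ∈ (R i).support}) A := by
  have hzi : ∀ i j, i ≠ j → z i ≠ z j := by
    intro i j hij h
    have hj : z i ∈ (R j).support := by
      rw [h]; exact (R j).end_mem_support
    exact hx (hdisj i j hij (z i) (R i).end_mem_support hj ▸ hz i)
  have key : ∀ {w : V}, w ∈ D → ∀ (P : G.Walk x w), P.IsPath → (∀ a ∈ P.support, a ∈ D → a = w) →
      ∀ k, (∀ a ∈ P.support, a ∈ (R k).support → a = x) → w ≠ z k →
      (∀ y y', s(x, y) ∈ P.edges → s(x, y') ∈ (R k).edges → c y ≠ c y') →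
      ∀ {u v : V} (Q : G.Walk u v), (∀ e ∈ Q.edges, e ∈ P.edges) →
      (∀ e ∈ P.edges, e ∈ A ∨ e ∈ Q.edges) →
      ∃ S, G.IsBicolouredEar D x c S ∧ S ⊆ A ∪ {e | e ∈ Q.edges} ∧ {e | e ∈ Q.edges} ⊆ S := by
    intro w hw P hP hPD k hPk hwk hck u v Q hQP hPQ
    refine ⟨_, ⟨w, hw, z k, hz k, hwk, P, R k, hP, hR k, hPD, hRD k, hPk, hck, rfl⟩, ?_, ?_⟩
    · rintro e (he | he)
      · exact hPQ e he
      · exact Or.inl (hRA k e he)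
    · intro e he
      exact Or.inl (hQP e he)
  have hcol : ∀ {w : V} (P : G.Walk x w), P.IsPath → ∀ j k, j ≠ k →
      (∀ y y', s(x, y) ∈ P.edges → s(x, y') ∈ (R j).edges → c y ≠ c y') ∨
      (∀ y y', s(x, y) ∈ P.edges → s(x, y') ∈ (R k).edges → c y ≠ c y') := by
    intro w P hP j k hjk
    by_contra! h
    obtain ⟨⟨y₁, y₁', h1, h1', e1⟩, y₂, y₂', h2, h2', e2⟩ := h
    have : y₁ = y₂ := (hP.eq_snd_of_mem_edges h1).trans (hP.eq_snd_of_mem_edges h2).symm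
    subst this
    exact hc j k hjk y₁' y₂' h1' h2' (e1.symm.trans e2)
  -- the second end is in `D`
  have inD : ∀ {u v : V}, u ∉ D → v ∈ D → (∃ i, u ∈ (R i).support) → ∀ Q : G.Walk u v,
      Q.IsExternal (D ∪ {a | ∃ i, a ∈ (R i).support}) A →
      ∃ S, G.IsBicolouredEar D x c S ∧ S ⊆ A ∪ {e | e ∈ Q.edges} ∧ {e | e ∈ Q.edges} ⊆ S := by
    intro u v huD hvD ⟨i, hui⟩ Q hQ
    obtain ⟨q, r, hqr⟩ := Walk.mem_support_iff_exists_append.1 hui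
    have hqr' : (q.append r).IsPath := hqr ▸ hR i
    have hqR : ∀ t ∈ q.support, t ∈ (R i).support := fun t ht => by
      rw [hqr]; exact (Walk.mem_support_append_iff _ _).2 (Or.inl ht)
    have hqe : ∀ e ∈ q.edges, e ∈ (R i).edges := fun t ht => by
      rw [hqr, Walk.edges_append]; exact List.mem_append_left _ ht
    have hqD : ∀ t ∈ q.support, t ∉ D := by
      intro t ht htD
      have := hRD i t (hqR t ht) htD
      subst this
      exact huD (hqr'.eq_of_mem_append ht r.end_mem_support ▸ htD)
    have hP : (q.append Q).IsPath := by
      refine hqr'.of_append_left.append_of_inter hQ.1 fun t h1 h2 => ?_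
      rcases hQ.2.1 t h2 (Or.inr ⟨i, hqR t h1⟩) with h | h
      · exact h
      · exact absurd (h ▸ hvD) (hqD t h1)
    -- When `u = x` the segment `q` is trivial, so even `R i` may serve as the partner.
    have main : ∀ k, v ≠ z k → (k ≠ i ∨ u = x) →
      (∀ y y', s(x, y) ∈ (q.append Q).edges → s(x, y') ∈ (R k).edges → c y ≠ c y') →
      ∃ S, G.IsBicolouredEar D x c S ∧ S ⊆ A ∪ {e | e ∈ Q.edges} ∧ {e | e ∈ Q.edges} ⊆ S := by
      intro k hvk hk hck
      refine key hvD (q.append Q) hP ?_ k ?_ hvk hck Q (fun e he => by simp [he]) ?_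
      · intro t ht htD
        rcases (Walk.mem_support_append_iff _ _).1 ht with ht | ht
        · exact absurd htD (hqD t ht)
        · exact (hQ.2.1 t ht (Or.inl htD)).resolve_left fun h => huD (h ▸ htD)
      · have hq' : ∀ t ∈ q.support, t ∈ (R k).support → t = x := by
          intro t ht htk
          rcases hk with hk | rfl
          · exact hdisj k i hk t htk (hqR t ht)
          · rw [Walk.nil_iff_support_eq.1 (Walk.isPath_iff_nil.1 hqr'.of_append_left)] at ht
            simpa using ht
        intro t ht htk
        rcases (Walk.mem_support_append_iff _ _).1 ht with ht | ht
        · exact hq' t ht htk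
        · rcases hQ.2.1 t ht (Or.inr ⟨k, htk⟩) with rfl | rfl
          · exact hq' t q.end_mem_support htk
          · exact absurd (hRD k t htk hvD) hvk
      · intro e he
        rw [Walk.edges_append, List.mem_append] at he
        exact he.imp_left fun h => hRA i e (hqe e h)
    by_cases hux : u = x
    -- At most one of the three ends equals `v`, which leaves two partners to choose from by colour.
    · have : ∃ j k, j ≠ k ∧ v ≠ z j ∧ v ≠ z k := by
        by_cases h0 : v = z 0
        · exact ⟨1, 2, by decide, h0 ▸ hzi 0 1 (by decide), h0 ▸ hzi 0 2 (by decide)⟩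
        · by_cases h1 : v = z 1
          · exact ⟨0, 2, by decide, h0, h1 ▸ hzi 1 2 (by decide)⟩
          · exact ⟨0, 1, by decide, h0, h1⟩
      obtain ⟨j, k, hjk, hj, hk⟩ := this
      rcases hcol _ hP j k hjk with h | h
      · exact main j hj (Or.inr hux) h
      · exact main k hk (Or.inr hux) h
    · have : ∃ k, k ≠ i ∧ v ≠ z k := by
        have hi : i + 1 ≠ i ∧ i + 2 ≠ i ∧ i + 1 ≠ i + 2 :=
          (by decide : ∀ i : Fin 3, i + 1 ≠ i ∧ i + 2 ≠ i ∧ i + 1 ≠ i + 2) i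
        by_cases h : v = z (i + 1)
        · exact ⟨i + 2, hi.2.1, h ▸ hzi _ _ hi.2.2⟩
        · exact ⟨i + 1, hi.1, h⟩
      obtain ⟨k, hki, hk⟩ := this
      refine main k hk (Or.inl hki) fun y y' hy hy' => ?_
      rw [Walk.edges_append, List.mem_append] at hy
      rcases hy with hy | hy
      · exact hc i k hki.symm y y' (hqe _ hy) hy'
      · rcases hQ.2.1 x (Walk.fst_mem_of_mem_edges hy) (Or.inr ⟨i, (R i).start_mem_support⟩)
          with h | h
        · exact absurd h.symm hux
        · exact absurd (h ▸ hvD) hx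
  -- neither end is in `D`
  have outD : ∀ {u v : V}, u ∉ D → v ∉ D → ∀ (i j : Fin 3) (q : G.Walk x u) (r : G.Walk v (z j)),
      q.IsPath → r.IsPath → (∀ t ∈ q.support, t ∈ r.support → False) →
      (∀ t ∈ q.support, t ∉ D) →
      (∀ t ∈ q.support, t ∈ (R i).support) → (∀ t ∈ r.support, t ∈ (R j).support) →
      (∀ t ∈ q.edges, t ∈ (R i).edges) → (∀ t ∈ r.edges, t ∈ (R j).edges) →
      (i = j ∨ (i ≠ j ∧ u ≠ x ∧ v ≠ x)) → ∀ Q : G.Walk u v,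
      Q.IsExternal (D ∪ {a | ∃ i, a ∈ (R i).support}) A →
      ∃ S, G.IsBicolouredEar D x c S ∧ S ⊆ A ∪ {e | e ∈ Q.edges} ∧ {e | e ∈ Q.edges} ⊆ S := by
    intro u v huD hvD i j q r hq hr hqr hqD hqR hrR hqe hre hij Q hQ
    have hrQ : ∀ t ∈ r.support, t ∈ Q.support → t = v := by
      intro t ht htQ
      refine (hQ.2.1 t htQ (Or.inr ⟨j, hrR t ht⟩)).resolve_left ?_
      rintro rfl
      exact hqr _ q.end_mem_support ht
    have hqQ : ∀ t ∈ q.support, t ∈ Q.support → t = u := by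
      intro t ht htQ
      refine (hQ.2.1 t htQ (Or.inr ⟨i, hqR t ht⟩)).resolve_right ?_
      rintro rfl
      exact hqr _ ht r.start_mem_support
    have hP : (q.append (Q.append r)).IsPath := by
      refine hq.append_of_inter (hQ.1.append_of_inter hr fun t h1 h2 => hrQ t h2 h1) ?_
      intro t h1 h2
      rcases (Walk.mem_support_append_iff _ _).1 h2 with h2 | h2
      · exact hqQ t h1 h2
      · exact (hqr t h1 h2).elim
    have main : ∀ k, k ≠ i → k ≠ j →
      (∀ y y', s(x, y) ∈ (q.append (Q.append r)).edges → s(x, y') ∈ (R k).edges → c y ≠ c y') →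
      ∃ S, G.IsBicolouredEar D x c S ∧ S ⊆ A ∪ {e | e ∈ Q.edges} ∧ {e | e ∈ Q.edges} ⊆ S := by
      intro k hki hkj hck
      refine key (hz j) _ hP ?_ k ?_ (hzi j k hkj.symm) hck Q (fun e he => by simp [he]) ?_
      · intro t ht htD
        simp only [Walk.mem_support_append_iff] at ht
        rcases ht with ht | ht | ht
        · exact (hqD t ht htD).elim
        · rcases hQ.2.1 t ht (Or.inl htD) with rfl | rfl
          · exact absurd htD huD
          · exact absurd htD hvD
        · exact hRD j t (hrR t ht) htD
      · intro t ht htk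
        simp only [Walk.mem_support_append_iff] at ht
        rcases ht with ht | ht | ht
        · exact hdisj k i hki t htk (hqR t ht)
        · rcases hQ.2.1 t ht (Or.inr ⟨k, htk⟩) with rfl | rfl
          · exact hdisj k i hki _ htk (hqR _ q.end_mem_support)
          · exact hdisj k j hkj _ htk (hrR _ r.start_mem_support)
        · exact hdisj k j hkj t htk (hrR t ht)
      · intro e he
        simp only [Walk.edges_append, List.mem_append] at he
        rcases he with he | he | he
        · exact Or.inl (hRA i e (hqe e he))
        · exact Or.inr he
        · exact Or.inl (hRA j e (hre e he))
    rcases hij with rfl | ⟨hij, hux, hvx⟩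
    -- Here `u` may be `x`, so the colour of the first edge is not known to be that of `R i`. Both
    -- other paths are available, and one has a different colour.
    · have hi : i + 1 ≠ i ∧ i + 2 ≠ i ∧ i + 1 ≠ i + 2 :=
        (by decide : ∀ i : Fin 3, i + 1 ≠ i ∧ i + 2 ≠ i ∧ i + 1 ≠ i + 2) i
      rcases hcol _ hP _ _ hi.2.2 with h | h
      · exact main _ hi.1 hi.1 h
      · exact main _ hi.2.1 hi.2.1 h
    · obtain ⟨k, hki, hkj⟩ := (by decide : ∀ i j : Fin 3, ∃ k, k ≠ i ∧ k ≠ j) i j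
      refine main k hki hkj fun y y' hy hy' => ?_
      simp only [Walk.edges_append, List.mem_append] at hy
      rcases hy with hy | hy | hy
      · exact hc i k hki.symm y y' (hqe _ hy) hy'
      · rcases hQ.2.1 x (Walk.fst_mem_of_mem_edges hy) (Or.inr ⟨i, (R i).start_mem_support⟩)
          with h | h
        · exact absurd h.symm hux
        · exact absurd h.symm hvx
      · exact hc j k hkj.symm y y' (hre _ hy) hy'
  have flip : ∀ {u v : V} (Q : G.Walk u v), (∃ S, G.IsBicolouredEar D x c S ∧
      S ⊆ A ∪ {e | e ∈ Q.reverse.edges} ∧ {e | e ∈ Q.reverse.edges} ⊆ S) →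
      ∃ S, G.IsBicolouredEar D x c S ∧ S ⊆ A ∪ {e | e ∈ Q.edges} ∧ {e | e ∈ Q.edges} ⊆ S := by
    intro u v Q h
    simpa using h
  have start : ∀ {i : Fin 3} {u : V} (q : G.Walk x u) (r : G.Walk u (z i)), u ∉ D →
      R i = q.append r → q.IsPath ∧ r.IsPath ∧ (∀ t ∈ q.support, t ∈ r.support → t = u) ∧
      (∀ t ∈ q.support, t ∉ D) ∧ (∀ t ∈ q.support, t ∈ (R i).support) ∧
      (∀ t ∈ r.support, t ∈ (R i).support) ∧ (∀ e ∈ q.edges, e ∈ (R i).edges) ∧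
      (∀ e ∈ r.edges, e ∈ (R i).edges) := by
    intro i u q r hu hqr
    have hqr' : (q.append r).IsPath := hqr ▸ hR i
    have hqR : ∀ t ∈ q.support, t ∈ (R i).support := fun t ht => by
      rw [hqr]; exact (Walk.mem_support_append_iff _ _).2 (Or.inl ht)
    refine ⟨hqr'.of_append_left, hqr'.of_append_right, fun t => hqr'.eq_of_mem_append, ?_, hqR,
      fun t ht => ?_, fun t ht => ?_, fun t ht => ?_⟩
    · intro t ht htD
      have := hRD i t (hqR t ht) htD
      subst this
      exact hu (hqr'.eq_of_mem_append ht r.end_mem_support ▸ htD)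
    · rw [hqr]; exact (Walk.mem_support_append_iff _ _).2 (Or.inr ht)
    · rw [hqr, Walk.edges_append]; exact List.mem_append_left _ ht
    · rw [hqr, Walk.edges_append]; exact List.mem_append_right _ ht
  have same : ∀ {u v : V}, u ∉ D → v ∉ D → u ≠ v → ∀ (i : Fin 3) (q : G.Walk x u)
      (m : G.Walk u v) (r : G.Walk v (z i)), R i = q.append (m.append r) → ∀ Q : G.Walk u v,
      Q.IsExternal (D ∪ {a | ∃ i, a ∈ (R i).support}) A →
      ∃ S, G.IsBicolouredEar D x c S ∧ S ⊆ A ∪ {e | e ∈ Q.edges} ∧ {e | e ∈ Q.edges} ⊆ S := by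
    intro u v hu hv huv i q m r hqr Q hQ
    obtain ⟨h1, -, h3, h4, h5, -, h7, -⟩ := start q (m.append r) hu hqr
    obtain ⟨-, g2, g3, -, -, g6, -, g8⟩ := start (q.append m) r hv
      (by rw [hqr, Walk.append_assoc])
    refine outD hu hv i i q r h1 g2 ?_ h4 h5 g6 h7 g8 (Or.inl rfl) Q hQ
    intro t ht htr
    have e1 := h3 t ht ((Walk.mem_support_append_iff _ _).2 (Or.inr htr))
    have e2 := g3 t ((Walk.mem_support_append_iff _ _).2 (Or.inl ht)) htr
    exact huv (e1.symm.trans e2)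
  intro u hu v hv huv hD Q hQ
  by_cases huD : u ∈ D
  · have hvD : v ∉ D := fun h => hD ⟨huD, h⟩
    exact flip Q (inD hvD huD (hv.resolve_left hvD) Q.reverse hQ.reverse)
  by_cases hvD : v ∈ D
  · exact inD huD hvD (hu.resolve_left huD) Q hQ
  by_cases hboth : ∃ i, u ∈ (R i).support ∧ v ∈ (R i).support
  · obtain ⟨i, hui, hvi⟩ := hboth
    obtain ⟨q, r, hqr⟩ := Walk.mem_support_iff_exists_append.1 hui
    rw [hqr, Walk.mem_support_append_iff] at hvi
    rcases hvi with h | h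
    · obtain ⟨q₁, q₂, rfl⟩ := Walk.mem_support_iff_exists_append.1 h
      exact flip Q (same hvD huD huv.symm i q₁ q₂ r (by rw [hqr, Walk.append_assoc]) Q.reverse
        hQ.reverse)
    · obtain ⟨r₁, r₂, rfl⟩ := Walk.mem_support_iff_exists_append.1 h
      exact same huD hvD huv i q r₁ r₂ hqr Q hQ
  · push Not at hboth
    obtain ⟨i, hui⟩ := hu.resolve_left huD
    obtain ⟨j, hvj⟩ := hv.resolve_left hvD
    obtain ⟨q, q', hq⟩ := Walk.mem_support_iff_exists_append.1 hui
    obtain ⟨r', r, hr⟩ := Walk.mem_support_iff_exists_append.1 hvj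
    obtain ⟨h1, -, -, h4, h5, -, h7, -⟩ := start q q' huD hq
    obtain ⟨-, g2, g3, -, -, g6, -, g8⟩ := start r' r hvD hr
    have hij : i ≠ j := fun h => hboth i hui (h ▸ hvj)
    have hvx : v ≠ x := fun h => hboth i hui (h ▸ (R i).start_mem_support)
    have hux : u ≠ x := fun h => hboth j (h ▸ (R j).start_mem_support) hvj
    refine outD huD hvD i j q r h1 g2 ?_ h4 h5 g6 h7 g8 (Or.inr ⟨hij, hux, hvx⟩) Q hQ
    intro t ht htr
    have := hdisj i j hij t (h5 t ht) (g6 t htr)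
    subst this
    exact hvx (g3 t r'.start_mem_support htr).symm

theorem isEarFrame_of_three_paths [Finite V] (hz : ∀ i, z i ∈ D) (hR : ∀ i, (R i).IsPath)
    (hRD : ∀ i, ∀ a ∈ (R i).support, a ∈ D → a = z i) (hx : x ∉ D)
    (hdisj : ∀ i j, i ≠ j → ∀ a ∈ (R i).support, a ∈ (R j).support → a = x)
    (hc : ∀ i j, i ≠ j → ∀ y y', s(x, y) ∈ (R i).edges → s(x, y') ∈ (R j).edges → c y ≠ c y')
    {B : Set (Sym2 V)} (hB : ∀ a b, s(a, b) ∈ B ↔ a ∈ D ∧ b ∈ D ∧ G.Adj a b)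
    (hBD : B.ncard ≤ D.ncard) :
    G.IsEarFrame D x c (D ∪ {a | ∃ i, a ∈ (R i).support}) (B ∪ {e | ∃ i, e ∈ (R i).edges}) where
  subset := Set.subset_union_left
  mem := Or.inr ⟨0, (R 0).start_mem_support⟩
  mem_of_edge a b h := by
    rcases h with h | ⟨i, hi⟩
    · exact Or.inl ((hB a b).1 h).1
    · exact Or.inr ⟨i, Walk.fst_mem_of_mem_edges hi⟩
  edge_mem a ha b hb h := Or.inl ((hB a b).2 ⟨ha, hb, h⟩)
  completable := isCompletable_of_three_paths hz hR hRD hx hdisj hc fun i e he => Or.inr ⟨i, he⟩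
  count := by
    -- The first path meets `D` only at its end and adds no more edges than vertices. Each of the
    -- other two meets the previous part at both ends and adds at most one extra edge. Hence `|A| ≤
    -- |U| + 2`, which three ears balance.
    have h0 := (hR 0).ncard_union_edges_le_of_pendant D B (hRD 0)
    have h1 := (hR 1).ncard_union_edges_le (D ∪ {a | a ∈ (R 0).support})
      (B ∪ {e | e ∈ (R 0).edges}) (by
        rintro a ha (h | h)
        · exact Or.inr (hRD 1 a ha h)
        · exact Or.inl (hdisj 1 0 (by decide) a ha h))
    have h2 := (hR 2).ncard_union_edges_le
      (D ∪ {a | a ∈ (R 0).support} ∪ {a | a ∈ (R 1).support})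
      (B ∪ {e | e ∈ (R 0).edges} ∪ {e | e ∈ (R 1).edges}) (by
        rintro a ha ((h | h) | h)
        · exact Or.inr (hRD 2 a ha h)
        · exact Or.inl (hdisj 2 0 (by decide) a ha h)
        · exact Or.inl (hdisj 2 1 (by decide) a ha h))
    have hA : B ∪ {e | ∃ i, e ∈ (R i).edges} =
        B ∪ {e | e ∈ (R 0).edges} ∪ {e | e ∈ (R 1).edges} ∪ {e | e ∈ (R 2).edges} := by
      ext e
      simp [Fin.exists_fin_succ, or_assoc]
    have hU : D ∪ {a | ∃ i, a ∈ (R i).support} = D ∪ {a | a ∈ (R 0).support} ∪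
        {a | a ∈ (R 1).support} ∪ {a | a ∈ (R 2).support} := by
      ext e
      simp [Fin.exists_fin_succ, or_assoc]
    rw [← hA, ← hU] at h2
    have hzi : ∀ i j, i ≠ j → z i ≠ z j := by
      intro i j hij h
      have hj : z i ∈ (R j).support := by
        rw [h]; exact (R j).end_mem_support
      exact hx (hdisj i j hij (z i) (R i).end_mem_support hj ▸ hz i)
    let S : Fin 3 → Set (Sym2 V) := fun k =>
      {e | e ∈ (R (k + 1)).edges} ∪ {e | e ∈ (R (k + 2)).edges}
    have hfin := (by decide : ∀ i : Fin 3, i + 1 ≠ i ∧ i + 2 ≠ i ∧ i + 1 ≠ i + 2)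
    have hSmem : ∀ i k : Fin 3, i ≠ k → ∀ e ∈ (R i).edges, e ∈ S k := by
      intro i k hik e he
      rcases (by decide : ∀ i k : Fin 3, i ≠ k → i = k + 1 ∨ i = k + 2) i k hik with rfl | rfl
      · exact Or.inl he
      · exact Or.inr he
    have hSinj : Function.Injective S := by
      intro k k' hkk'
      by_contra hne
      -- The first edge of `R k` lies in every `S k'` with `k' ≠ k`, but not in `S k`.
      obtain ⟨y, hy⟩ := (R k).exists_mem_edges (fun h => hx (h ▸ hz k))
      have hyk : y ∈ (R k).support := (R k).snd_mem_support_of_mem_edges hy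
      have hxy : x ≠ y := ((R k).adj_of_mem_edges hy).ne
      have h := hSmem k k' hne _ hy
      rw [← hkk'] at h
      rcases h with h | h
      · exact hxy (hdisj k _ (hfin k).1.symm y hyk ((R _).snd_mem_support_of_mem_edges h)).symm
      · exact hxy (hdisj k _ (hfin k).2.1.symm y hyk ((R _).snd_mem_support_of_mem_edges h)).symm
    have hSgood : Set.range S ⊆ {T | G.IsBicolouredEar D x c T ∧
        T ⊆ B ∪ {e | ∃ i, e ∈ (R i).edges}} := by
      rintro _ ⟨k, rfl⟩
      refine ⟨⟨_, hz (k + 1), _, hz (k + 2), hzi _ _ (hfin k).2.2, R _, R _, hR _, hR _, hRD _,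
        hRD _, hdisj _ _ (hfin k).2.2, hc _ _ (hfin k).2.2, rfl⟩, ?_⟩
      rintro e (he | he)
      · exact Or.inr ⟨_, he⟩
      · exact Or.inr ⟨_, he⟩
    have h3 := Set.ncard_le_ncard hSgood (Set.toFinite _)
    rw [Set.ncard_range_of_injective hSinj, Nat.card_fin] at h3
    omega

end Theta

end SimpleGraph

/-! ### Closing ears along `D` to cycles of prescribed parity -/

namespace SimpleGraph.Walk

variable {V : Type*} {G : SimpleGraph V}

/-- Two vertices of a cycle split it into two paths. -/
theorem IsCycle.exists_arcs {v z z' : V} {w : G.Walk v v} (hw : w.IsCycle) (hz : z ∈ w.support)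
    (hz' : z' ∈ w.support) (hne : z ≠ z') :
    ∃ p q : G.Walk z z', p.IsPath ∧ q.IsPath ∧ (w.edges.Perm (p.edges ++ q.edges)) ∧
      p.support ⊆ w.support ∧ q.support ⊆ w.support := by
  classical
  have hz'r : z' ∈ (w.rotate z hz).support := (mem_support_rotate_iff w z hz).2 hz'
  obtain ⟨p, q, hpq⟩ := mem_support_iff_exists_append.1 hz'r
  have hcyc : (p.append q).IsCycle := hpq ▸ hw.rotate hz
  have hp : ¬ p.Nil := not_nil_of_ne hne
  have hq : ¬ q.Nil := not_nil_of_ne hne.symm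
  refine ⟨p, q.reverse, hcyc.isPath_of_append_left hq, (hcyc.isPath_of_append_right hp).reverse,
    ?_, ?_, ?_⟩
  · have h := (rotate_edges w z hz).perm
    rw [hpq, edges_append] at h
    rw [edges_reverse]
    exact h.symm.trans ((List.reverse_perm _).symm.append_left _)
  · intro a ha
    rw [← mem_support_rotate_iff w z hz, hpq]
    exact (mem_support_append_iff _ _).2 (Or.inl ha)
  · intro a ha
    rw [← mem_support_rotate_iff w z hz, hpq]
    exact (mem_support_append_iff _ _).2 (Or.inr (by simpa using ha))

/-- Two paths from `x` sharing only `x` close up to a cycle along a path in a set that they meet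
only in their last vertices. -/
theorem IsPath.isCycle_append_reverse {x z z' : V} {D : Set V} {P : G.Walk x z} {P' : G.Walk x z'}
    {p : G.Walk z z'} (hP : P.IsPath) (hP' : P'.IsPath) (hp : p.IsPath)
    (hPD : ∀ a ∈ P.support, a ∈ D → a = z) (hPD' : ∀ a ∈ P'.support, a ∈ D → a = z')
    (hPP' : ∀ a ∈ P.support, a ∈ P'.support → a = x) (hpD : ∀ a ∈ p.support, a ∈ D)
    (hx : x ∉ D) (hne : z ≠ z') : ((P.append p).append P'.reverse).IsCycle := by
  have hPp : (P.append p).IsPath := hP.append_of_inter hp fun a h1 h2 => hPD a h1 (hpD a h2)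
  refine hPp.isCycle_append hP'.reverse ?_ (Or.inl ?_)
  · intro a h1 h2
    have hn1 := hPp.support_nodup
    rw [← cons_tail_support, List.nodup_cons] at hn1
    have hn2 := hP'.reverse.support_nodup
    rw [← cons_tail_support, List.nodup_cons] at hn2
    have h2' : a ∈ P'.support := by simpa using List.mem_of_mem_tail h2
    rcases (mem_support_append_iff _ _).1 (List.mem_of_mem_tail h1) with h | h
    · exact hn1.1 (hPP' a h h2' ▸ h1)
    · exact hn2.1 (hPD' a h2' (hpD a h) ▸ h2)
  · have h1 : 0 < P.length := by
      rw [Nat.pos_iff_ne_zero]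
      intro h
      exact hx (eq_of_length_eq_zero h ▸ hpD z p.start_mem_support)
    have h2 : 0 < p.length := by
      rw [Nat.pos_iff_ne_zero]
      intro h
      exact hne (eq_of_length_eq_zero h)
    rw [length_append]
    omega

end SimpleGraph.Walk

namespace SignedGraph

open SimpleGraph

variable {V κ : Type*} (G : SignedGraph V)

open Classical in
/-- The sign of an edge, extended by `0` to pairs that are not edges. -/
noncomputable def signExt (e : Sym2 V) : ZMod 2 :=
  if h : e ∈ G.graph.edgeSet then G.sign ⟨e, h⟩ else 0

/-- A cycle repeats no edge, so its parity is a sum over the edge list, which is additive under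
concatenation and invariant under reversal. -/
theorem parity_toSubgraph {v : V} {w : G.graph.Walk v v} (hw : w.IsCycle) :
    G.parity w.toSubgraph = (w.edges.map G.signExt).sum := by
  classical
  have h1 : G.parity w.toSubgraph = ∑ᶠ e : w.toSubgraph.edgeSet, G.signExt e := by
    refine finsum_congr fun e => ?_
    rw [signExt, dif_pos (w.toSubgraph.edgeSet_subset e.2)]
  have h2 : w.toSubgraph.edgeSet = (w.edges.toFinset : Set (Sym2 V)) := by
    ext e; simp
  rw [h1, finsum_set_coe_eq_finsum_mem, h2, finsum_mem_coe_finset,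
    List.sum_toFinset _ hw.isTrail.edges_nodup]

open Classical in
/-- A colouring of the edges at `x`, viewed as a colouring of the vertices. -/
noncomputable def neighborColor {x : V} (f : G.graph.incidenceSet x → κ) (y : V) : Option κ :=
  if h : G.graph.Adj x y then some (f ⟨s(x, y), h, Sym2.mem_mk_left x y⟩) else none

variable {G}

theorem exists_neighborColor_eq {x : V} (f : G.graph.incidenceSet x → κ)
    (e : G.graph.incidenceSet x) : ∃ y, e.1 = s(x, y) ∧ G.neighborColor f y = some (f e) := by
  obtain ⟨e, he, hx⟩ := e
  obtain ⟨y, rfl⟩ := hx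
  exact ⟨y, rfl, dif_pos he⟩

/-- Every bicoloured ear extends along an odd cycle to a cycle of any given parity. -/
theorem exists_isCycle_of_isBicolouredEar {x : V} {D : G.graph.Subgraph} (hD : G.IsCycle D)
    (hodd : G.parity D = 1) (hx : x ∉ D.verts) (f : G.graph.incidenceSet x → κ) (q : ZMod 2)
    {S : Set (Sym2 V)} (hS : G.graph.IsBicolouredEar D.verts x (G.neighborColor f) S) :
    ∃ C : G.graph.Subgraph, (G.IsCycle C ∧ G.parity C = q ∧ x ∈ C.verts ∧
      G.HasDistinctColorsAt x f C) ∧ C.edgeSet \ D.edgeSet = S := by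
  obtain ⟨v, w, hw, rfl⟩ := hD
  obtain ⟨z, hz, z', hz', hne, P, P', hP, hP', hPD, hPD', hPP', hcol, rfl⟩ := hS
  obtain ⟨p, r, hp, hr, hperm, hpw, hrw⟩ := hw.exists_arcs ((w.mem_verts_toSubgraph).1 hz)
    ((w.mem_verts_toSubgraph).1 hz') hne
  have main : ∀ a : G.graph.Walk z z', a.IsPath → a.support ⊆ w.support →
      (∀ e ∈ a.edges, e ∈ w.edges) →
      (P.edges.map G.signExt).sum + (a.edges.map G.signExt).sum +
        (P'.edges.map G.signExt).sum = q → ∃ C : G.graph.Subgraph, (G.IsCycle C ∧ G.parity C = q ∧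
        x ∈ C.verts ∧ G.HasDistinctColorsAt x f C) ∧ C.edgeSet \ w.toSubgraph.edgeSet =
          {e | e ∈ P.edges} ∪ {e | e ∈ P'.edges} := by
    intro a ha haw hae hq
    have hcyc := hP.isCycle_append_reverse hP' ha hPD hPD' hPP'
      (fun t ht => (w.mem_verts_toSubgraph).2 (haw ht)) hx hne
    refine ⟨_, ⟨⟨x, _, hcyc, rfl⟩, ?_, ?_, ?_⟩, ?_⟩
    · rw [parity_toSubgraph G hcyc]
      simp only [Walk.edges_append, Walk.edges_reverse, List.map_append, List.map_reverse,
        List.sum_append, List.sum_reverse]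
      exact hq
    · exact Walk.start_mem_verts_toSubgraph _
    · intro e₁ e₂ h₁ h₂ h12
      obtain ⟨y₁, hy₁, hf₁⟩ := exists_neighborColor_eq f e₁
      obtain ⟨y₂, hy₂, hf₂⟩ := exists_neighborColor_eq f e₂
      have hside : ∀ y, s(x, y) ∈ ((P.append a).append P'.reverse).toSubgraph.edgeSet →
          s(x, y) ∈ P.edges ∨ s(x, y) ∈ P'.edges := by
        intro y h
        rw [Walk.mem_edges_toSubgraph] at h
        simp only [Walk.edges_append, Walk.edges_reverse, List.mem_append, List.mem_reverse] at h
        rcases h with (h | h) | h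
        · exact Or.inl h
        · exact absurd ((w.mem_verts_toSubgraph).2 (haw (Walk.fst_mem_of_mem_edges h))) hx
        · exact Or.inr h
      have hy12 : y₁ ≠ y₂ := by
        rintro rfl
        exact h12 (Subtype.ext (hy₁.trans hy₂.symm))
      have hcne : G.neighborColor f y₁ ≠ G.neighborColor f y₂ := by
        rcases hside y₁ (hy₁ ▸ h₁) with g₁ | g₁ <;> rcases hside y₂ (hy₂ ▸ h₂) with g₂ | g₂
        · exact absurd ((hP.eq_snd_of_mem_edges g₁).trans (hP.eq_snd_of_mem_edges g₂).symm) hy12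
        · exact hcol _ _ g₁ g₂
        · exact (hcol _ _ g₂ g₁).symm
        · exact absurd ((hP'.eq_snd_of_mem_edges g₁).trans (hP'.eq_snd_of_mem_edges g₂).symm) hy12
      exact fun h => hcne (by rw [hf₁, hf₂, h])
    -- A path meeting `D` only in its last vertex has no edge in `D`. Hence removing the edges of
    -- `D` gives back exactly the ear.
    · have hout : ∀ {t : V} (T : G.graph.Walk x t),
          (∀ b ∈ T.support, b ∈ w.toSubgraph.verts → b = t) → ∀ e ∈ T.edges, e ∉ w.edges := by
        intro t T hT e he hew
        induction e with
        | _ b d =>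
          have h1 := hT b (T.fst_mem_support_of_mem_edges he)
            ((w.mem_verts_toSubgraph).2 (w.fst_mem_support_of_mem_edges hew))
          have h2 := hT d (T.snd_mem_support_of_mem_edges he)
            ((w.mem_verts_toSubgraph).2 (w.snd_mem_support_of_mem_edges hew))
          exact (T.adj_of_mem_edges he).ne (h1.trans h2.symm)
      ext e
      simp only [Set.mem_sdiff, Walk.mem_edges_toSubgraph, Walk.edges_append, Walk.edges_reverse,
        List.mem_append, List.mem_reverse, Set.mem_union, Set.mem_ofPred_eq]
      constructor
      · rintro ⟨(h | h) | h, h'⟩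
        · exact Or.inl h
        · exact absurd (hae e h) h'
        · exact Or.inr h
      · rintro (h | h)
        · exact ⟨Or.inl (Or.inl h), hout P hPD e h⟩
        · exact ⟨Or.inr h, hout P' hPD' e h⟩
  rw [parity_toSubgraph G hw, (hperm.map _).sum_eq, List.map_append, List.sum_append] at hodd
  have hpe : ∀ e ∈ p.edges, e ∈ w.edges := fun e he => hperm.mem_iff.2 (List.mem_append_left _ he)
  have hre : ∀ e ∈ r.edges, e ∈ w.edges := fun e he => hperm.mem_iff.2 (List.mem_append_right _ he)
  -- The parities `b` and `c` of the two arcs sum to the odd parity of `D`, so they differ and one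
  -- of them gives total parity `q`.
  have h2 : ∀ a b c d q : ZMod 2, b + c = 1 → a + b + d = q ∨ a + c + d = q := by decide
  rcases h2 (P.edges.map G.signExt).sum _ _ (P'.edges.map G.signExt).sum q hodd with h | h
  · exact main p hp hpw hpe h
  · exact main r hr hrw hre h

theorem IsCycle.ncard_edgeSet_le [Finite V] {D : G.graph.Subgraph} (hD : G.IsCycle D) :
    D.edgeSet.ncard ≤ D.verts.ncard := by
  classical
  obtain ⟨v, w, hw, rfl⟩ := hD
  have h1 : w.toSubgraph.edgeSet = {e | e ∈ w.edges} := by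
    ext e; simp
  -- The support lists the base vertex twice; its tail lists each vertex once.
  have h2 : ({a | a ∈ w.support.tail} : Set V).ncard = w.length := by
    rw [← List.coe_toFinset, Set.ncard_coe_finset, List.toFinset_card_of_nodup hw.support_nodup]
    simp
  rw [h1, hw.isTrail.ncard_setOf_mem_edges, ← h2]
  exact Set.ncard_le_ncard (fun a ha => (w.mem_verts_toSubgraph).2 (List.mem_of_mem_tail ha))
    (Set.toFinite _)

end SignedGraph

/-! ### Assembly -/

theorem SimpleGraph.exists_walk_of_connected_induce {V : Type*} {G : SimpleGraph V} {s : Set V}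
    (h : (G.induce s).Connected) {a b : V} (ha : a ∈ s) (hb : b ∈ s) :
    ∃ w : G.Walk a b, ∀ t ∈ w.support, t ∈ s := by
  have key : ∀ {u v : s} (p : (G.induce s).Walk u v), ∃ w : G.Walk u v, ∀ t ∈ w.support, t ∈ s := by
    intro u v p
    induction p with
    | @nil u => exact ⟨Walk.nil, fun t ht => by simp_all⟩
    | @cons u _ _ h _ ih =>
      obtain ⟨w, hw⟩ := ih
      refine ⟨Walk.cons h w, fun t ht => ?_⟩
      rcases List.mem_cons.1 ht with rfl | ht
      · exact u.2
      · exact hw t ht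
  obtain ⟨w⟩ := h.preconnected ⟨a, ha⟩ ⟨b, hb⟩
  exact key w

theorem lemma5p1 {V κ : Type*} [Finite V] (G : SignedGraph V)
    (h3 : G.IsThreeConnected) (hnb : ¬ G.IsBipartite)
    (x : V) (D : G.graph.Subgraph)
    (hDcycle : G.IsCycle D) (hDodd : G.parity D = 1) (hDind : D.IsInduced)
    (hDsep : G.IsNonSeparating D) (hxD : x ∉ D.verts)
    (y z : Fin 3 → V) (hz : ∀ i, z i ∈ D.verts)
    (R : ∀ i, G.graph.Walk x (z i)) (hR : ∀ i, (R i).IsPath)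
    (hdisj : ∀ i j, i ≠ j → ∀ v, v ∈ (R i).support → v ∈ (R j).support → v = x)
    (hy : ∀ i, s(x, y i) ∈ (R i).edges)
    (f : G.graph.incidenceSet x → κ)
    (hf : Function.Injective fun i : Fin 3 =>
      f ⟨s(x, y i), (R i).edges_subset_edgeSet (hy i), Sym2.mem_mk_left x (y i)⟩) :
    ∀ q : ZMod 2,
      G.t ≤ ({C : G.graph.Subgraph | G.IsCycle C ∧ G.parity C = q ∧ x ∈ C.verts ∧
        G.HasDistinctColorsAt x f C}.ncard : ℤ) := by
  intro q
  -- The given paths may meet `D` before `z i`, so each is cut at its first vertex in `D`. Its first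
  -- edge survives because `x` is not in `D`.
  have hfirst : ∀ i, ∃ t ∈ D.verts, ∃ P : G.graph.Walk x t, P.IsPath ∧
      P.support ⊆ (R i).support ∧ P.edges ⊆ (R i).edges ∧
      ∀ a ∈ P.support, a ∈ D.verts → a = t := by
    intro i
    obtain ⟨t, ht, P, r, hPr, hP⟩ := (R i).exists_append_first_mem D.verts (hz i)
    refine ⟨t, ht, P, (hPr ▸ hR i : (P.append r).IsPath).of_append_left, fun a ha => ?_,
      fun a ha => ?_, hP⟩
    · rw [hPr]; exact (SimpleGraph.Walk.mem_support_append_iff _ _).2 (Or.inl ha)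
    · rw [hPr, SimpleGraph.Walk.edges_append]; exact List.mem_append_left _ ha
  choose t ht P hP hPR hPRe hPD using hfirst
  have hcolor : ∀ i b, s(x, b) ∈ (P i).edges → G.neighborColor f b =
      some (f ⟨s(x, y i), (R i).edges_subset_edgeSet (hy i), Sym2.mem_mk_left x (y i)⟩) := by
    intro i b hb
    have : b = y i := ((hR i).eq_snd_of_mem_edges (hPRe i hb)).trans
      ((hR i).eq_snd_of_mem_edges (hy i)).symm
    subst this
    exact dif_pos ((R i).edges_subset_edgeSet (hy i))
  have hframe := SimpleGraph.isEarFrame_of_three_paths (B := D.edgeSet) ht hP hPD hxD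
    (fun i j hij a h1 h2 => hdisj i j hij a (hPR i h1) (hPR j h2))
    (c := G.neighborColor f)
    (fun i j hij b b' hb hb' h => hij (hf (Option.some_injective _
      ((hcolor i b hb).symm.trans (h.trans (hcolor j b' hb'))))))
    (fun a b => ⟨fun h => ⟨D.edge_vert h, D.edge_vert (SimpleGraph.Subgraph.Adj.symm h),
      D.adj_sub h⟩,
      -- Since `D` is induced, the initial edge set contains every edge of the graph inside `D`,
      -- while still having at most as many edges as `D` has vertices.
      fun h => hDind h.1 h.2.1 h.2.2⟩) hDcycle.ncard_edgeSet_le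
  have hcount := hframe.ncard_edgeSet_le hxD (fun a ha b hba => by
      obtain ⟨w, hw⟩ := SimpleGraph.exists_walk_of_connected_induce (a := b) (b := z 0)
        (h3.2 {a} (by rw [Set.ncard_singleton]; omega)) hba (fun h => ha (h ▸ hz 0))
      exact ⟨z 0, hz 0, w, fun h => hw a h rfl⟩)
    (fun b hb => SimpleGraph.exists_walk_of_connected_induce hDsep hb hxD)
  choose! C hC hCS using fun S (hS : S ∈ {S | G.graph.IsBicolouredEar D.verts x
    (G.neighborColor f) S}) =>
      SignedGraph.exists_isCycle_of_isBicolouredEar hDcycle hDodd hxD f q hS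
  -- The chosen cycles are distinct because each determines its ear as its edges outside `D`.
  have hle := Set.ncard_le_ncard_of_injOn (t := {C : G.graph.Subgraph | G.IsCycle C ∧
    G.parity C = q ∧ x ∈ C.verts ∧ G.HasDistinctColorsAt x f C}) C hC
    (fun S hS T hT h => by rw [← hCS S hS, ← hCS T hT, h]) (Set.toFinite _)
  rw [SignedGraph.t, Nat.card_coe_set_eq]
  omega
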